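/- For every fixed integer $t \ge 2$, the maximum order of a distance-$d$ semi-ladder in a finite graph of treewidth at most $t$ is bounded from above by $d^{O(d^{t+1})}$. Precisely: for every integer $t \ge 2$ there is a constant $C = C(t)$ such that for every integer $d \ge 2$, every finite simple undirected graph $G$ of treewidth at most $t$, and every distance-$d$ semi-ladder in $G$ of order $\ell$, we have $$\ell \le d^{\,C d^{t+1}}.$$ Here a distance-$d$ semi-ladder of order $\ell$ in $G$ consists of $2\ell$ pairwise different vertices $a_1,\dots,a_\ell,b_1,\dots,b_\ell$ such that $\mathrm{dist}_G(b_i,a_j)\le d$ whenever $1\le i<j\le \ell$, and $\mathrm{dist}_G(b_i,a_i)>d$ for each $1\le i\le \ell$, where the distance of vertices in different components is $+\infty$. -/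

import Mathlib

namespace SimpleGraph

/-- A tree decomposition of `G` over a tree with vertex set `ι`. -/
structure TreeDecomposition {V : Type*} (G : SimpleGraph V) (ι : Type*) where
  /-- The underlying tree. -/
  tree : SimpleGraph ι
  isTree : tree.IsTree
  /-- The bag of a tree node. -/
  bag : ι → Finset V
  /-- Both ends of every edge lie in a common bag. -/
  exists_bag_of_adj : ∀ ⦃u v : V⦄, G.Adj u v → ∃ i, u ∈ bag i ∧ v ∈ bag i
  /-- The nodes whose bags contain `v` form a (nonempty) connected subtree. -/
  connected_bags : ∀ v : V, (tree.induce {i | v ∈ bag i}).Connected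

/-- The width of a tree decomposition over a finite tree: the maximum size of a bag, minus one.
It is an integer, so that no truncation occurs if all bags are empty. -/
def TreeDecomposition.width {V ι : Type*} [Fintype ι] {G : SimpleGraph V}
    (D : G.TreeDecomposition ι) : ℤ :=
  ((Finset.univ.sup fun i => (D.bag i).card : ℕ) : ℤ) - 1

/-- The treewidth of a finite graph: the minimum width of a tree decomposition, the tree being a
finite tree, with vertex set `Fin n` without loss of generality. -/
noncomputable def treewidth {V : Type*} [Finite V] (G : SimpleGraph V) : ℤ :=
  sInf {w : ℤ | ∃ (n : ℕ) (D : G.TreeDecomposition (Fin n)), D.width = w}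

/-- The infimum in the definition of the treewidth is a minimum. -/
theorem exists_width_eq_treewidth {V : Type*} [Finite V] (G : SimpleGraph V) :
    ∃ (n : ℕ) (D : G.TreeDecomposition (Fin n)), D.width = G.treewidth := by
  have hne : {w : ℤ | ∃ (n : ℕ) (D : G.TreeDecomposition (Fin n)), D.width = w}.Nonempty := by
    have := Fintype.ofFinite V
    refine ⟨_, 1, ⟨⊥, ?_, fun _ => Finset.univ, by simp, fun v => ?_⟩, rfl⟩
    · exact IsTree.of_subsingleton
    · have : Nonempty ({i : Fin 1 | v ∈ (Finset.univ : Finset V)} : Set (Fin 1)) :=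
        ⟨⟨0, by simp⟩⟩
      exact ⟨Preconnected.of_subsingleton⟩
  have hbd : BddBelow {w : ℤ | ∃ (n : ℕ) (D : G.TreeDecomposition (Fin n)), D.width = w} := by
    refine ⟨-1, ?_⟩
    rintro w ⟨n, D, rfl⟩
    unfold TreeDecomposition.width
    omega
  exact Int.csInf_mem hne hbd

/-- The `2 * ℓ` distinct vertices `a i`, `b i` form a distance-`d` semi-ladder of order `ℓ` in `G`.
The distance `G.edist` between vertices in different components is `⊤`. -/
structure IsDistSemiLadder {V : Type*} (G : SimpleGraph V) (d : ℕ) {ℓ : ℕ} (a b : Fin ℓ → V) :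
    Prop where
  injective_left : Function.Injective a
  injective_right : Function.Injective b
  ne : ∀ i j, a i ≠ b j
  edist_le : ∀ i j, i < j → G.edist (b i) (a j) ≤ (d : ℕ∞)
  lt_edist : ∀ i, (d : ℕ∞) < G.edist (b i) (a i)

end SimpleGraph

/-!
Fix a linear order of the vertices, and say that `v` weakly `d`-reaches `u` if some walk of length
at most `d` from `v` to `u` has `u` as its least vertex. The proof has two halves.

*Few weakly reachable vertices force short semi-ladders* (`IsDistSemiLadder.card_le`). Suppose that
every vertex weakly `d`-reaches at most `w` vertices, and let `a`, `b` be a semi-ladder. The least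
vertex `z` of a shortest path from the first `b i` to a later `a j` is weakly reachable from both
ends. By pigeonhole, one `z` and one distance from `z` to `a j` serve a fraction `1 / (w * (d + 1))`
of all `j`. Restrict to these, and repeat. Each round produces a new `z`: a short path from `b i`
to `a j` through an old `z` would give an equally short walk from `b i` to `a i`, since `a i` and
`a j` are equally far from `z`. After `w + 1` rounds, any `a j` left over would weakly reach `w + 1`
vertices, so the order is at most `(w * (d + 1) + 1) ^ (w + 1)`.

*Treewidth at most `t` allows `w = (t + 1)! * (d + 1) ^ t`*
(`exists_linearOrder_card_weaklyReachable_le`). Root a tree decomposition and order the vertices by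
the depth of the shallowest node whose bag contains them. Join each `x` to the smaller vertices in
the bag of its shallowest node: this is a descending relation whose out-neighbourhoods are cliques
of size at most `t`, and a weakly `d`-reachable vertex is reached by at most `d` steps of it. The
vertices reached in this way are counted by induction on `t` (`card_reachableWithin_le`): a chain
descending to the least of them meets the out-neighbourhood of every other one that is not on it,
so deleting the chain, of at most `d + 1` vertices, lowers all out-degrees.
-/

namespace SimpleGraph

/-! ### Counting in clique-like descending relations -/

/-- `ReachableWithin R r v x`: there is a chain of at most `r` steps of `R` from `v` to `x`. -/
def ReachableWithin {V : Type*} (R : V → V → Prop) : ℕ → V → V → Prop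
  | 0, v, x => v = x
  | r + 1, v, x => v = x ∨ ∃ y, R v y ∧ ReachableWithin R r y x

namespace ReachableWithin

variable {V : Type*} {R : V → V → Prop}

theorem refl (r : ℕ) (v : V) : ReachableWithin R r v v := by
  cases r
  · rfl
  · exact Or.inl rfl

theorem mono {r s : ℕ} (h : r ≤ s) {v x : V} (hx : ReachableWithin R r v x) :
    ReachableWithin R s v x := by
  induction r generalizing v s with
  | zero => obtain rfl : v = x := hx; exact refl s v
  | succ r ih =>
    obtain ⟨s, rfl⟩ : ∃ s', s = s' + 1 := ⟨s - 1, by omega⟩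
    rcases hx with rfl | ⟨y, hy, hyx⟩
    · exact refl _ _
    · exact Or.inr ⟨y, hy, ih (by omega) hyx⟩

theorem reflTransGen {r : ℕ} {v x : V} (hx : ReachableWithin R r v x) :
    Relation.ReflTransGen R v x := by
  induction r generalizing v with
  | zero => obtain rfl : v = x := hx; exact .refl
  | succ r ih =>
    rcases hx with rfl | ⟨y, hy, hyx⟩
    · exact .refl
    · exact .head hy (ih hyx)

theorem eq_of_forall_not {r : ℕ} {v x : V} (hx : ReachableWithin R r v x)
    (hv : ∀ y, ¬ R v y) : v = x := by
  cases r with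
  | zero => exact hx
  | succ r => exact hx.resolve_right fun ⟨y, hy, _⟩ => hv y hy

end ReachableWithin

section Descending

variable {V : Type*} [LinearOrder V] {R : V → V → Prop}

theorem le_of_reflTransGen (hlt : ∀ x y, R x y → y < x) {v x : V}
    (h : Relation.ReflTransGen R v x) : x ≤ v := by
  induction h with
  | refl => exact le_rfl
  | tail _ h ih => exact (hlt _ _ h).le.trans ih

/-- The vertices reachable from `v` form a chain under reachability: a reachable `m` below an
out-neighbour `y` of `v` is reachable from `y`. -/
theorem reflTransGen_of_lt (hcl : ∀ x y m, R x y → R x m → y < m → R m y) {v m y : V}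
    (hm : Relation.ReflTransGen R v m) (hy : R v y) (hmv : m ≠ v) (hmy : m < y) :
    Relation.ReflTransGen R y m := by
  induction hm using Relation.ReflTransGen.head_induction_on with
  | refl => exact absurd rfl hmv
  | @head v u huv hum ih =>
    rcases lt_trichotomy u y with h | rfl | h
    · exact .head (hcl _ _ _ huv hy h) hum
    · exact hum
    · exact ih (hcl _ _ _ hy huv h) (hmy.trans h).ne

theorem rel_of_reflTransGen (hlt : ∀ x y, R x y → y < x)
    (hcl : ∀ x y m, R x y → R x m → y < m → R m y) {v m y : V}
    (hm : Relation.ReflTransGen R v m) (hy : R v y) (hym : y < m) : R m y := by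
  induction hm using Relation.ReflTransGen.head_induction_on with
  | refl => exact hy
  | @head v u huv hum ih =>
    exact ih (hcl _ _ _ hy huv (hym.trans_le (le_of_reflTransGen hlt hum)))

/-- A descending chain from `v` to `x` hits an out-neighbour of every vertex that is reachable
from `v`, lies above `x` and is not itself on the chain. -/
theorem exists_dominating_chain (hlt : ∀ x y, R x y → y < x)
    (hcl : ∀ x y m, R x y → R x m → y < m → R m y) {r : ℕ} {v x : V}
    (hx : ReachableWithin R r v x) :
    ∃ P : Finset V, P.card ≤ r + 1 ∧ v ∈ P ∧ x ∈ P ∧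
      ∀ m, Relation.ReflTransGen R v m → x < m → m ∉ P → ∃ w ∈ P, R m w := by
  induction r generalizing v with
  | zero =>
    obtain rfl : v = x := hx
    exact ⟨{v}, by simp, by simp, by simp,
      fun m hm hvm _ => absurd (le_of_reflTransGen hlt hm) hvm.not_ge⟩
  | succ r ih =>
    rcases hx with rfl | ⟨y, hy, hyx⟩
    · exact ⟨{v}, by simp, by simp, by simp,
        fun m hm hvm _ => absurd (le_of_reflTransGen hlt hm) hvm.not_ge⟩
    · obtain ⟨P, hP, hyP, hxP, hdom⟩ := ih hyx
      refine ⟨insert v P, (Finset.card_insert_le _ _).trans (by omega), by simp, by simp [hxP], ?_⟩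
      intro m hm hxm hmP
      rw [Finset.mem_insert, not_or] at hmP
      rcases lt_trichotomy y m with h | rfl | h
      · exact ⟨y, by simp [hyP], rel_of_reflTransGen hlt hcl hm hy h⟩
      · exact absurd hyP hmP.2
      · obtain ⟨w, hw, hmw⟩ := hdom m (reflTransGen_of_lt hcl hm hy hmP.1 h) hxm hmP.2
        exact ⟨w, by simp [hw], hmw⟩

open Classical in
/-- If the out-neighbourhoods of a descending relation are cliques of size at most `k`, then at
most `(k + 1)! * (r + 1) ^ k` vertices are reachable from `v` in at most `r` steps. By induction on
`k`: deleting a chain from `v` to the least such vertex lowers all out-degrees in question, and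
every other vertex is reached from an out-neighbour of the chain without touching it again. -/
theorem card_reachableWithin_le [Fintype V] (k : ℕ) (R : V → V → Prop)
    (hlt : ∀ x y, R x y → y < x) (hcl : ∀ x y m, R x y → R x m → y < m → R m y)
    (hdeg : ∀ x, (Finset.univ.filter (R x)).card ≤ k) (r : ℕ) (v : V) :
    (Finset.univ.filter (ReachableWithin R r v)).card ≤ (k + 1).factorial * (r + 1) ^ k := by
  induction k generalizing R v with
  | zero =>
    have : Finset.univ.filter (ReachableWithin R r v) ⊆ {v} := by
      intro x hx
      have h : ∀ y, ¬ R v y := fun y hy => by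
        have := Finset.card_pos.2 ⟨y, Finset.mem_filter.2 ⟨Finset.mem_univ y, hy⟩⟩
        exact absurd (hdeg v) (by omega)
      simpa using ((Finset.mem_filter.1 hx).2.eq_of_forall_not h).symm
    simpa using Finset.card_le_card this
  | succ k ih =>
    obtain ⟨z, hz, hmin⟩ := Finset.exists_min_image (Finset.univ.filter (ReachableWithin R r v)) id
      ⟨v, by simp [ReachableWithin.refl]⟩
    simp only [Finset.mem_filter, Finset.mem_univ, true_and, id] at hz hmin
    obtain ⟨P, hP, hvP, hzP, hdom⟩ := exists_dominating_chain hlt hcl hz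
    -- Delete `P` and restrict to the region where `P` dominates.
    let R' : V → V → Prop := fun x y =>
      R x y ∧ Relation.ReflTransGen R v x ∧ x ∉ P ∧ y ∉ P ∧ z ≤ y
    have hdeg' : ∀ x, (Finset.univ.filter (R' x)).card ≤ k := by
      intro x
      rcases (Finset.univ.filter (R' x)).eq_empty_or_nonempty with h | ⟨y, hy⟩
      · simp [h]
      · obtain ⟨hxy, hvx, hxP, -, hzy⟩ := (Finset.mem_filter.1 hy).2
        obtain ⟨w, hw, hxw⟩ := hdom x hvx (hzy.trans_lt (hlt _ _ hxy)) hxP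
        have hsub : Finset.univ.filter (R' x) ⊆ (Finset.univ.filter (R x)).erase w := by
          intro u hu
          have hu := (Finset.mem_filter.1 hu).2
          exact Finset.mem_erase.2 ⟨fun h => hu.2.2.2.1 (h ▸ hw), by simp [hu.1]⟩
        have h1 := Finset.card_le_card hsub
        rw [Finset.card_erase_of_mem (by simp [hxw])] at h1
        have := hdeg x
        omega
    -- Cut a chain from `u` to `x` after its last vertex in `P`.
    have key : ∀ s ≤ r, ∀ u x, Relation.ReflTransGen R v u → ReachableWithin R s u x → z ≤ x →
        ReachableWithin R' s u x ∨ x ∈ P ∨ ∃ q ∈ P, ∃ y, R q y ∧ ReachableWithin R' r y x := by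
      intro s
      induction s with
      | zero => exact fun _ u x _ hux _ => Or.inl hux
      | succ s ihs =>
        intro hs u x hvu hux hzx
        rcases hux with rfl | ⟨y, huy, hyx⟩
        · exact Or.inl (.refl _ _)
        rcases ihs (by omega) y x (hvu.tail huy) hyx hzx with h | h | h
        · by_cases hu : u ∈ P
          · exact Or.inr (Or.inr ⟨u, hu, y, huy, h.mono (by omega)⟩)
          by_cases hy : y ∈ P
          · obtain rfl := h.eq_of_forall_not fun _ h => h.2.2.1 hy
            exact Or.inr (Or.inl hy)
          · exact Or.inl (Or.inr ⟨y, ⟨huy, hvu, hu, hy,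
              hzx.trans (le_of_reflTransGen hlt hyx.reflTransGen)⟩, h⟩)
        · exact Or.inr (Or.inl h)
        · exact Or.inr (Or.inr h)
    have hcover : Finset.univ.filter (ReachableWithin R r v) ⊆
        P ∪ P.biUnion fun q => (Finset.univ.filter (R q)).biUnion fun y =>
          Finset.univ.filter (ReachableWithin R' r y) := by
      intro x hx
      have hx := (Finset.mem_filter.1 hx).2
      simp only [Finset.mem_union, Finset.mem_biUnion, Finset.mem_filter, Finset.mem_univ,
        true_and]
      rcases key r le_rfl v x .refl hx (hmin x hx) with h | h | h
      · obtain rfl := h.eq_of_forall_not fun _ h => h.2.2.1 hvP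
        exact Or.inl hvP
      · exact Or.inl h
      · exact Or.inr h
    set X := (k + 1).factorial * (r + 1) ^ k with hX
    have hX1 : 1 ≤ X := Nat.mul_pos (Nat.factorial_pos _) (by positivity)
    have hbi : (P.biUnion fun q => (Finset.univ.filter (R q)).biUnion fun y =>
          Finset.univ.filter (ReachableWithin R' r y)).card ≤ (r + 1) * ((k + 1) * X) := by
      refine (Finset.card_biUnion_le_card_mul _ _ ((k + 1) * X) fun q _ => ?_).trans
        (Nat.mul_le_mul_right _ hP)
      refine (Finset.card_biUnion_le_card_mul _ _ X fun y _ => ?_).trans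
        (Nat.mul_le_mul_right _ (hdeg q))
      exact ih R' (fun x y h => hlt x y h.1)
        (fun x y m hy hm h => ⟨hcl x y m hy.1 hm.1 h, hm.2.1.tail hm.1, hm.2.2.2.1, hy.2.2.2⟩)
        (fun x => by convert hdeg' x) y
    calc _ ≤ (r + 1) + (r + 1) * ((k + 1) * X) :=
          (Finset.card_le_card hcover).trans ((Finset.card_union_le _ _).trans
            (Nat.add_le_add hP hbi))
      _ ≤ (r + 1) * ((k + 2) * X) := by nlinarith
      _ = _ := by rw [hX, Nat.factorial_succ (k + 1)]; ring

end Descending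

/-! ### Semi-ladders and weak reachability -/

/-- `G.WeaklyReachable r v u`: there is a walk of length at most `r` from `v` to `u` on which `u` is
the least vertex. -/
def WeaklyReachable {V : Type*} [LinearOrder V] (G : SimpleGraph V) (r : ℕ) (v u : V) : Prop :=
  ∃ p : G.Walk v u, p.length ≤ r ∧ ∀ x ∈ p.support, u ≤ x

/-- The least vertex of a shortest path from `u` to `v` is weakly reachable from both ends. -/
theorem exists_weaklyReachable_of_edist_le {V : Type*} [LinearOrder V] {G : SimpleGraph V}
    {d : ℕ} {u v : V} (h : G.edist u v ≤ d) :
    ∃ z, G.WeaklyReachable d u z ∧ G.WeaklyReachable d v z ∧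
      G.edist u z + G.edist z v ≤ d := by
  obtain ⟨p, hp⟩ := exists_walk_of_edist_ne_top (ne_top_of_le_ne_top (ENat.natCast_ne_top d) h)
  have hpd : p.length ≤ d := by rw [← hp] at h; exact_mod_cast h
  obtain ⟨z, hz, hmin⟩ := Finset.exists_min_image p.support.toFinset id ⟨u, by simp⟩
  simp only [List.mem_toFinset, id] at hz hmin
  have hlen : (p.takeUntil z hz).length + (p.dropUntil z hz).length = p.length := by
    rw [← Walk.length_append, Walk.take_spec]
  refine ⟨z, ⟨p.takeUntil z hz, by omega,
      fun x hx => hmin x (p.support_takeUntil_subset_support hz hx)⟩,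
    ⟨(p.dropUntil z hz).reverse, by rw [Walk.length_reverse]; omega, fun x hx => ?_⟩, ?_⟩
  · rw [Walk.support_reverse, List.mem_reverse] at hx
    exact hmin x (p.support_dropUntil_subset_support hz hx)
  · refine (add_le_add (p.takeUntil z hz).edist_le (p.dropUntil z hz).edist_le).trans ?_
    rw [← Nat.cast_add, hlen]
    exact_mod_cast hpd

open Classical in
/-- If every vertex weakly `d`-reaches at most `w` vertices, then a set `I` of indices of a
semi-ladder is small as soon as there is a large set `S` of vertices, weakly reachable from every
`a i`, whose distances to `a i` do not depend on `i ∈ I`. The least vertices of shortest paths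
from `b (min I)` to the other `a j` are never in `S`, so that by pigeonhole `S` can be enlarged
without shrinking `I` too much. -/
theorem IsDistSemiLadder.card_le {V : Type*} [Fintype V] [LinearOrder V] {G : SimpleGraph V}
    {d w : ℕ} (hw : ∀ v, (Finset.univ.filter (G.WeaklyReachable d v)).card ≤ w) {ℓ : ℕ}
    {a b : Fin ℓ → V} (h : G.IsDistSemiLadder d a b) (k : ℕ) (I : Finset (Fin ℓ)) (S : Finset V)
    (hS : w + 1 ≤ S.card + k) (hreach : ∀ i ∈ I, ∀ z ∈ S, G.WeaklyReachable d (a i) z)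
    (hdist : ∀ i ∈ I, ∀ j ∈ I, ∀ z ∈ S, G.edist z (a i) = G.edist z (a j)) :
    I.card ≤ (w * (d + 1) + 1) ^ k := by
  induction k generalizing I S with
  | zero =>
    obtain rfl : I = ∅ := by
      refine Finset.eq_empty_of_forall_notMem fun i hi => ?_
      have h1 : S ⊆ Finset.univ.filter (G.WeaklyReachable d (a i)) :=
        fun z hz => by simpa using hreach i hi z hz
      have := (Finset.card_le_card h1).trans (hw (a i))
      omega
    simp
  | succ k ih =>
    rcases I.eq_empty_or_nonempty with rfl | hI
    · simp
    let i₀ := I.min' hI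
    have hi₀ : i₀ ∈ I := I.min'_mem hI
    have hex : ∀ j : Fin ℓ, ∃ z, j ∈ I.erase i₀ →
        G.WeaklyReachable d (b i₀) z ∧ G.WeaklyReachable d (a j) z ∧
          G.edist (b i₀) z + G.edist z (a j) ≤ d := fun j => by
      by_cases hj : j ∈ I.erase i₀
      · obtain ⟨z, hz⟩ := exists_weaklyReachable_of_edist_le
          (h.edist_le i₀ j (I.min'_lt_of_mem_erase_min' hI hj))
        exact ⟨z, fun _ => hz⟩
      · exact ⟨a j, fun h => absurd h hj⟩
    choose z hz using hex
    have hmem : ∀ j ∈ I.erase i₀, (z j, G.edist (z j) (a j)) ∈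
        (Finset.univ.filter (G.WeaklyReachable d (b i₀))) ×ˢ
          (Finset.range (d + 1)).image ((↑) : ℕ → ℕ∞) := by
      intro j hj
      obtain ⟨h1, -, h3⟩ := hz j hj
      obtain ⟨n, hn, hnd⟩ := ENat.le_natCast_iff.1 (le_add_self.trans h3)
      simp only [Finset.mem_product, Finset.mem_filter, Finset.mem_univ, true_and,
        Finset.mem_image, Finset.mem_range]
      exact ⟨h1, n, by omega, hn.symm⟩
    have hfib : ∀ c ∈ (Finset.univ.filter (G.WeaklyReachable d (b i₀))) ×ˢ
          (Finset.range (d + 1)).image ((↑) : ℕ → ℕ∞),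
        ((I.erase i₀).filter fun j => (z j, G.edist (z j) (a j)) = c).card ≤
          (w * (d + 1) + 1) ^ k := by
      rintro ⟨y, e⟩ -
      set J := (I.erase i₀).filter fun j => (z j, G.edist (z j) (a j)) = (y, e) with hJ
      have hJmem : ∀ j ∈ J, j ∈ I.erase i₀ ∧ z j = y ∧ G.edist y (a j) = e := by
        intro j hj
        obtain ⟨h1, h2⟩ := Finset.mem_filter.1 hj
        obtain ⟨rfl, rfl⟩ := Prod.mk.inj h2
        exact ⟨h1, rfl, rfl⟩
      rcases J.eq_empty_or_nonempty with hJe | ⟨j, hj⟩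
      · simp [hJe]
      -- A walk from `b i₀` to `a j` through `y ∈ S` could be redirected to `a i₀`.
      have hyS : y ∉ S := by
        intro hyS
        obtain ⟨h1, rfl, -⟩ := hJmem j hj
        have h3 := (hz j h1).2.2
        rw [← hdist i₀ hi₀ j (Finset.mem_of_mem_erase h1) _ hyS] at h3
        exact (h.lt_edist i₀).not_ge (SimpleGraph.edist_triangle.trans h3)
      refine ih J (insert y S) (by rw [Finset.card_insert_of_notMem hyS]; omega) ?_ ?_
      · intro i hi x hx
        obtain ⟨h1, h2, -⟩ := hJmem i hi
        rcases Finset.mem_insert.1 hx with rfl | hx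
        · exact h2 ▸ (hz i h1).2.1
        · exact hreach i (Finset.mem_of_mem_erase h1) x hx
      · intro i hi i' hi' x hx
        obtain ⟨h1, -, h2⟩ := hJmem i hi
        obtain ⟨h1', -, h2'⟩ := hJmem i' hi'
        rcases Finset.mem_insert.1 hx with rfl | hx
        · rw [h2, h2']
        · exact hdist i (Finset.mem_of_mem_erase h1) i' (Finset.mem_of_mem_erase h1') x hx
    have hcard := Finset.card_le_mul_card_image_of_maps_to hmem _ hfib
    rw [Finset.card_erase_of_mem hi₀, Finset.card_product] at hcard
    have hprod : (Finset.univ.filter (G.WeaklyReachable d (b i₀))).card *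
        ((Finset.range (d + 1)).image ((↑) : ℕ → ℕ∞)).card ≤ w * (d + 1) :=
      Nat.mul_le_mul (hw _) (Finset.card_image_le.trans (by simp))
    have h1 := hcard.trans (Nat.mul_le_mul_left _ hprod)
    have h2 : 1 ≤ (w * (d + 1) + 1) ^ k := Nat.one_le_pow _ _ (by omega)
    rw [pow_succ, mul_add, mul_one]
    omega

end SimpleGraph

namespace SimpleGraph

/-! ### Connected sets in rooted trees -/

section RootedTree

variable {ι : Type*} {T : SimpleGraph ι}

/-- In a tree with root `ρ`, let `U` be a connected set with `u` as a vertex of least depth. The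
path from `ρ` to any `x ∈ U` passes through `u`, and its vertices at least as deep as `u` are
in `U`. -/
theorem IsTree.path_through_shallowest (hT : T.IsTree) {ρ u x : ι} {U : Set ι}
    (hU : (T.induce U).Connected) (hu : u ∈ U) (hx : x ∈ U)
    (hmin : ∀ y ∈ U, T.dist ρ u ≤ T.dist ρ y) {p : T.Walk ρ x} (hp : p.IsPath) :
    u ∈ p.support ∧ ∀ y ∈ p.support, T.dist ρ u ≤ T.dist ρ y → y ∈ U := by
  classical
  obtain ⟨p₁, hp₁, hlen⟩ := hT.1.exists_path_of_dist ρ u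
  obtain ⟨q, hq, -⟩ := hU.exists_path_of_dist ⟨u, hu⟩ ⟨x, hx⟩
  let p₂ : T.Walk u x := q.map (Embedding.induce U).toHom
  have hp₂ : p₂.IsPath := hq.map (Embedding.induce (G := T) U).injective
  have hp₂U : ∀ y ∈ p₂.support, y ∈ U := by
    intro y hy
    change y ∈ (q.map (Embedding.induce (G := T) U).toHom).support at hy
    rw [Walk.support_map, List.mem_map] at hy
    obtain ⟨⟨y', hy'⟩, -, rfl⟩ := hy
    exact hy'
  have hp₁U : ∀ y ∈ p₁.support, T.dist ρ u ≤ T.dist ρ y → y = u := by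
    intro y hy hle
    have h1 := T.dist_le (p₁.takeUntil y hy)
    have h2 : (p₁.takeUntil y hy).length + (p₁.dropUntil y hy).length = p₁.length := by
      rw [← Walk.length_append, Walk.take_spec]
    exact Walk.eq_of_length_eq_zero (p := p₁.dropUntil y hy) (by omega)
  have happ : (p₁.append p₂).IsPath := by
    rw [Walk.isPath_def, Walk.support_append, List.nodup_append']
    refine ⟨hp₁.support_nodup, hp₂.support_nodup.tail, fun y h1 h2 => ?_⟩
    obtain rfl := hp₁U y h1 (hmin y (hp₂U y (List.mem_of_mem_tail h2)))
    have := hp₂.support_nodup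
    rw [← Walk.cons_tail_support] at this
    exact (List.nodup_cons.1 this).1 h2
  obtain rfl : p = p₁.append p₂ :=
    congrArg Subtype.val ((hT.isAcyclic.subsingleton_path ρ x).elim ⟨p, hp⟩ ⟨_, happ⟩)
  refine ⟨by simp, fun y hy hle => ?_⟩
  rcases (Walk.mem_support_append_iff _ _).1 hy with h | h
  · exact hp₁U y h hle ▸ hu
  · exact hp₂U y h

/-- If two connected sets of a rooted tree intersect, the one reaching higher contains the
shallowest vertex of the other one. -/
theorem IsTree.shallowest_mem_of_inter (hT : T.IsTree) {ρ s u x : ι} {S U : Set ι}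
    (hS : (T.induce S).Connected) (hU : (T.induce U).Connected)
    (hs : s ∈ S) (hsmin : ∀ y ∈ S, T.dist ρ s ≤ T.dist ρ y)
    (hu : u ∈ U) (humin : ∀ y ∈ U, T.dist ρ u ≤ T.dist ρ y)
    (hxS : x ∈ S) (hxU : x ∈ U) (hle : T.dist ρ s ≤ T.dist ρ u) : u ∈ S := by
  obtain ⟨p, hp, -⟩ := hT.1.exists_path_of_dist ρ x
  exact (hT.path_through_shallowest hS hs hxS hsmin hp).2 u
    (hT.path_through_shallowest hU hu hxU humin hp).1 hle

end RootedTree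

/-! ### Weak reachability in graphs of bounded treewidth -/

open Classical in
/-- The graphs of treewidth at most `t` have polynomially bounded weak colouring numbers. Vertices
are ordered by the depth of the shallowest node `top v` whose bag contains `v`. A vertex weakly
reachable from `v` is reached by jumps from `x` to smaller members of the bag of `top x`, and
such jumps form a descending relation with cliques as out-neighbourhoods. -/
theorem exists_linearOrder_card_weaklyReachable_le {V : Type*} [Fintype V] {G : SimpleGraph V}
    {t : ℕ} (hG : G.treewidth ≤ t) :
    ∃ _ : LinearOrder V, ∀ r v,
      (Finset.univ.filter (G.WeaklyReachable r v)).card ≤ (t + 1).factorial * (r + 1) ^ t := by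
  obtain ⟨n, D, hD⟩ := exists_width_eq_treewidth G
  have hbag : ∀ i, (D.bag i).card ≤ t + 1 := fun i => by
    have h1 : (D.bag i).card ≤ Finset.univ.sup fun i => (D.bag i).card :=
      Finset.le_sup (f := fun i => (D.bag i).card) (Finset.mem_univ i)
    unfold TreeDecomposition.width at hD
    omega
  obtain ⟨ρ⟩ := D.isTree.1.nonempty
  have hT := D.isTree
  have htop : ∀ v, ∃ i, v ∈ D.bag i ∧ ∀ j, v ∈ D.bag j → D.tree.dist ρ i ≤ D.tree.dist ρ j := by
    intro v
    obtain ⟨⟨i, hi⟩⟩ := (D.connected_bags v).nonempty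
    obtain ⟨j, hj, hmin⟩ := Finset.exists_min_image (Finset.univ.filter fun i => v ∈ D.bag i)
      (D.tree.dist ρ) ⟨i, by simpa using hi⟩
    exact ⟨j, by simpa using hj, fun k hk => hmin k (by simpa using hk)⟩
  choose top htop hmin using htop
  let key : V → ℕ ×ₗ Fin (Fintype.card V) :=
    fun v => toLex (D.tree.dist ρ (top v), Fintype.equivFin V v)
  have hkey : Function.Injective key := fun u v h =>
    (Fintype.equivFin V).injective (Prod.mk.inj (toLex.injective h)).2
  let o : LinearOrder V := LinearOrder.lift' key hkey
  have hdepth : ∀ {x y : V}, x ≤ y → D.tree.dist ρ (top x) ≤ D.tree.dist ρ (top y) := by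
    intro x y hxy
    have h : key x ≤ key y := hxy
    rcases Prod.Lex.le_iff.1 h with h | h
    · exact h.le
    · exact h.1.le
  let R : V → V → Prop := fun x y => y < x ∧ y ∈ D.bag (top x)
  have hcl : ∀ x y m, R x y → R x m → y < m → R m y := fun x y m hy hm hym =>
    ⟨hym, hT.shallowest_mem_of_inter (D.connected_bags y) (D.connected_bags m) (htop y) (hmin y)
      (htop m) (hmin m) hy.2 hm.2 (hdepth hym.le)⟩
  have hdeg : ∀ x, (Finset.univ.filter (R x)).card ≤ t := by
    intro x
    have hsub : Finset.univ.filter (R x) ⊆ (D.bag (top x)).erase x := fun y hy => by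
      have hy := (Finset.mem_filter.1 hy).2
      exact Finset.mem_erase.2 ⟨hy.1.ne, hy.2⟩
    have h1 := Finset.card_le_card hsub
    rw [Finset.card_erase_of_mem (htop x)] at h1
    have := hbag (top x)
    omega
  -- Follow a walk from `a`, with `U` the union of the subtrees of the vertices `≥ a` met so far,
  -- until its first vertex below `a`, which is an out-neighbour of `a`.
  have hwalk : ∀ {v z : V} (p : G.Walk v z), (∀ x ∈ p.support, z ≤ x) →
      ∀ (a : V) (U : Set (Fin n)), (D.tree.induce U).Connected → top a ∈ U →
        (∀ i ∈ U, D.tree.dist ρ (top a) ≤ D.tree.dist ρ i) → {i | v ∈ D.bag i} ⊆ U →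
        a ≤ v → z ≤ a → ReachableWithin R p.length a z := by
    intro v z p
    induction p with
    | nil =>
      intro _ a U _ _ _ _ hav hza
      exact hav.antisymm hza
    | @cons v v' z hadj p ih =>
      intro hz a U hU haU hUmin hvU hav hza
      have hz' : ∀ x ∈ p.support, z ≤ x := fun x hx => hz x (by simp [hx])
      obtain ⟨i, hiv, hiv'⟩ := D.exists_bag_of_adj hadj
      rcases lt_or_ge v' a with h | h
      · refine Or.inr ⟨v', ⟨h, ?_⟩, ih hz' v' _ (D.connected_bags v') (htop v') (hmin v')
          le_rfl le_rfl (hz' v' p.start_mem_support)⟩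
        exact hT.shallowest_mem_of_inter (D.connected_bags v') hU (htop v') (hmin v') haU hUmin
          hiv' (hvU hiv) (hdepth h.le)
      · refine (ih hz' a (U ∪ {i | v' ∈ D.bag i})
          (induce_union_connected hU.preconnected (D.connected_bags v').preconnected
            ⟨i, hvU hiv, hiv'⟩) (Or.inl haU) ?_ Set.subset_union_right h hza).mono (by simp)
        rintro j (hj | hj)
        · exact hUmin j hj
        · exact (hdepth h).trans (hmin v' j hj)
  refine ⟨o, fun r v => (Finset.card_le_card fun z hz => ?_).trans
    (card_reachableWithin_le t R (fun _ _ h => h.1) hcl (fun x => by convert hdeg x) r v)⟩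
  obtain ⟨p, hp, hpz⟩ := (Finset.mem_filter.1 hz).2
  exact Finset.mem_filter.2 ⟨Finset.mem_univ _, (hwalk p hpz v _ (D.connected_bags v) (htop v)
    (hmin v) le_rfl le_rfl (hpz v p.start_mem_support)).mono hp⟩

end SimpleGraph

/-! ### The bound -/

/-- The semi-ladder bound for `w = f * (d + 1) ^ t` has the shape `d ^ (C * d ^ (t + 1))`. -/
theorem pow_bound_le_pow_mul_pow (t f d : ℕ) (hd : 2 ≤ d) :
    (f * (d + 1) ^ t * (d + 1) + 1) ^ (f * (d + 1) ^ t + 1) ≤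
      d ^ ((f + 2 * t + 3) * (f * 2 ^ t + 1) * d ^ (t + 1)) := by
  have hd1 : d + 1 ≤ d ^ 2 := by nlinarith
  have hfd : f ≤ d ^ f := (Nat.lt_pow_self (by omega)).le
  have hbase : f * (d + 1) ^ t * (d + 1) + 1 ≤ d ^ (f + 2 * t + 3) := by
    have h1 : f * (d + 1) ^ t * (d + 1) ≤ d ^ (f + 2 * t + 2) := by
      calc _ ≤ d ^ f * (d ^ 2) ^ t * d ^ 2 := by gcongr
        _ = _ := by rw [← pow_mul, ← pow_add, ← pow_add]
    have h2 : 1 ≤ d ^ (f + 2 * t + 2) := Nat.one_le_pow _ _ (by omega)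
    calc _ ≤ d ^ (f + 2 * t + 2) * 2 := by omega
      _ ≤ d ^ (f + 2 * t + 2) * d := by gcongr
      _ = _ := (pow_succ _ _).symm
  have hexp : f * (d + 1) ^ t + 1 ≤ (f * 2 ^ t + 1) * d ^ (t + 1) := by
    calc f * (d + 1) ^ t + 1 ≤ f * (2 * d) ^ t + d ^ t := by
          gcongr
          · omega
          · exact Nat.one_le_pow _ _ (by omega)
      _ = (f * 2 ^ t + 1) * d ^ t := by rw [mul_pow]; ring
      _ ≤ _ := by
          gcongr
          · omega
          · omega
  calc _ ≤ (d ^ (f + 2 * t + 3)) ^ (f * (d + 1) ^ t + 1) := Nat.pow_le_pow_left hbase _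
    _ ≤ (d ^ (f + 2 * t + 3)) ^ ((f * 2 ^ t + 1) * d ^ (t + 1)) :=
        Nat.pow_le_pow_right (Nat.pow_pos (by omega)) hexp
    _ = _ := by rw [← pow_mul, mul_assoc]

theorem mainTheorem5 (t : ℕ) (ht : 2 ≤ t) :
    ∃ C : ℕ, ∀ d : ℕ, 2 ≤ d →
      ∀ (V : Type*) [Finite V] (G : SimpleGraph V), G.treewidth ≤ (t : ℤ) →
        ∀ (ℓ : ℕ) (a b : Fin ℓ → V), G.IsDistSemiLadder d a b →
          ℓ ≤ d ^ (C * d ^ (t + 1)) := by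
  classical
  refine ⟨((t + 1).factorial + 2 * t + 3) * ((t + 1).factorial * 2 ^ t + 1), ?_⟩
  intro d hd V _ G hG ℓ a b h
  have := Fintype.ofFinite V
  obtain ⟨o, ho⟩ := SimpleGraph.exists_linearOrder_card_weaklyReachable_le hG
  have h1 := h.card_le (fun v => ho d v) ((t + 1).factorial * (d + 1) ^ t + 1) Finset.univ ∅
    (by simp) (by simp) (by simp)
  rw [Finset.card_univ, Fintype.card_fin] at h1
  exact h1.trans (pow_bound_le_pow_mul_pow t _ d hd)
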